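/- Let $\Sigma$ be a finite alphabet, $\Sigma_\$=\Sigma\cup\{\$\}$ with a termination symbol $\$\notin\Sigma$, and $\Delta(\Sigma_\$)$ the set of probability distributions on $\Sigma_\$$; put $\mathsf{supp}(\rho)=\{\sigma\in\Sigma:\rho(\sigma)>0\}$. A PDFA $\mathcal A=(Q,q_{in},\pi,\tau)$ has a finite state set $Q$, $q_{in}\in Q$, and total maps $\pi:Q\to\Delta(\Sigma_\$)$, $\tau:Q\times\Sigma\to Q$; it defines the language model $\mathcal L(u)=\pi(\tau^*(u))$, $u\in\Sigma^*$. Let $P(\lambda)=1$, $P(u\sigma)=P(u)\,\mathcal L(u)(\sigma)$; the string $u$ is *defined* if $P(u)>0$. Let $E$ be any equivalence relation on $\Delta(\Sigma_\$)$ whose equivalent elements have the same support, written $=_E$. Write $u\equiv v$ if $u,v$ are both defined or both undefined, and $\mathcal L(uw)=_E\mathcal L(vw)$ for all $w\in\Sigma^*$ such that $uw$ and $vw$ are defined. This is an equivalence relation compatible with appending symbols, and all undefined strings form one class $\mathbf 0$. The quotient $\overline{\mathcal A}$ has the classes $[u]\ne\mathbf 0$ as states and $[\lambda]$ as initial state;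 $\tau([u],\sigma)=[u\sigma]$ if $u\sigma$ is defined, and otherwise (where the class is $\mathbf 0$) the transition is undefined; and $\pi(c)=\mathcal L(\alpha(c))$, where $\alpha(c)\in c$ is a chosen access string of $c$ and $\alpha([\lambda])=\lambda$. In an automaton with partial transitions a string is defined if it labels a path of transitions of positive probability. *The algorithm Omit-Zero* learns $\mathcal A$ from two kinds of queries. A membership query $u$ is answered by $\mathcal L(u)$ if $u$ is defined, and by "undefined" otherwise; let $\ell(u)$ be the $E$-class of $\mathcal L(u)$ if $u$ is defined, and $\ell(u)=\text{undefined}$ otherwise. An equivalence query for a hypothesis $\mathcal H$ is answered by any counterexample, i.e. any string $\gamma$ that is defined in $\mathcal H$ and satisfies $\mathcal L(\gamma)\ne_E\mathcal H(\gamma)$, or by $\bot$ if there is none. The algorithm keeps a tree $T$ whose leaves are access strings, whose inner nodes are distinguishing strings, and whose arcs from a node carry pairwise different values of $\ell$. Sifting $x$ means descending from the root, at a node $w$ along the arc labelled $\ell(xw)$. 1. Ask an equivalence query for the one-state hypothesis with distribution $\mathcal L(\lambda)$ and a loop for each $\sigma\in\mathsf{supp}(\mathcal L(\lambda))$. If the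 answer is $\bot$, return this hypothesis. If the answer is $\gamma$, let $x$ be the shortest prefix of $\gamma$ that is a counterexample, and let $T$ have root $\lambda$ and the two leaves $\lambda$ (along the arc $\ell(\lambda)$) and $x$ (along the arc $\ell(x)$). 2. (Build.) As long as there are a leaf $u$ and $\sigma\in\mathsf{supp}(\mathcal L(u))$ such that sifting $u\sigma$ meets a missing arc, add that arc and the leaf $u\sigma$ at its end (in any order). Then let $\mathcal H$ have a state $q_u$ with distribution $\mathcal L(u)$ for each leaf $u$, the initial state $q_\lambda$, and $\tau(q_u,\sigma)=q_{u'}$ with $u'$ the leaf to which $u\sigma$ is sifted if $\sigma\in\mathsf{supp}(\mathcal L(u))$; $\tau(q_u,\sigma)$ is undefined otherwise. 3. Ask an equivalence query for $\mathcal H$. If the answer is $\bot$, return $\mathcal H$. If the answer is $\gamma$, find the shortest prefix $x\sigma$ of $\gamma$ that is not sifted to the leaf $v$ whose state $\mathcal H$ reaches on $x\sigma$; let $w$ be the node at which the sifting paths of $x\sigma$ and $v$ separate; replace the leaf $u$ to which $x$ is sifted by an inner node $\sigma w$ with the two leaves $u$ (along $\ell(u\sigma w)$) and $x$ (along $\ell(x\sigma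 w)$). Go to 2. **Proposition.** For every PDFA $\mathcal A$ and every such $E$, whatever counterexamples the teacher chooses and in whatever order leaves are added, Omit-Zero terminates: no run is infinite, and no run gets stuck before it returns an automaton. Every returned automaton is isomorphic to the quotient $\overline{\mathcal A}$ (for some choice $\alpha$ of access strings). In particular it is finite, it is $\equiv$-equivalent to $\mathcal A$ (the same strings are defined, and on these the next-symbol distributions are $E$-equivalent), and it has the least number of states among all automata, with total or partial transitions, that are $\equiv$-equivalent to $\mathcal A$. -/

import Mathlib

open scoped Classical

namespace OmitZero

/-! ### Language models, supports, defined strings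

`S` is the finite alphabet, strings are `List S`, and `Option S` is the alphabet extended by the
termination symbol, which is `none`. -/

/-- The probability simplex over the alphabet extended by the termination symbol. -/
abbrev Dist (S : Type*) [Fintype S] : Type _ := stdSimplex ℝ (Option S)

/-- The symbols of positive probability. -/
def supp {S : Type*} [Fintype S] (ρ : Dist S) : Set S := {σ | 0 < ρ.1 (some σ)}

/-- A language model: a total map from strings to next-symbol distributions. -/
abbrev LanguageModel (S : Type*) [Fintype S] : Type _ := List S → Dist S

/-- `probAfter L u w` is the probability of reading `w` after `u`. -/
def probAfter {S : Type*} [Fintype S] (L : LanguageModel S) : List S → List S → ℝ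
  | _, [] => 1
  | u, σ :: w => (L u).1 (some σ) * probAfter L (u ++ [σ]) w

/-- The prefix probability of a string. -/
def prefixProb {S : Type*} [Fintype S] (L : LanguageModel S) (w : List S) : ℝ :=
  probAfter L [] w

/-- A string is defined if its prefix probability is positive. -/
def IsDef {S : Type*} [Fintype S] (L : LanguageModel S) (u : List S) : Prop :=
  0 < prefixProb L u

theorem probAfter_append_singleton {S : Type*} [Fintype S] (L : LanguageModel S)
    (u w : List S) (σ : S) :
    probAfter L u (w ++ [σ]) = probAfter L u w * (L (u ++ w)).1 (some σ) := by
  induction w generalizing u with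
  | nil => simp [probAfter]
  | cons a w ih => simp [probAfter, ih, mul_assoc]

theorem prefixProb_nil {S : Type*} [Fintype S] (L : LanguageModel S) : prefixProb L [] = 1 := rfl

theorem prefixProb_append_singleton {S : Type*} [Fintype S] (L : LanguageModel S)
    (u : List S) (σ : S) :
    prefixProb L (u ++ [σ]) = prefixProb L u * (L u).1 (some σ) := by
  simpa [prefixProb] using probAfter_append_singleton L [] u σ

theorem prefixProb_nonneg {S : Type*} [Fintype S] (L : LanguageModel S) (u : List S) :
    0 ≤ prefixProb L u := by
  induction u using List.reverseRecOn with
  | nil => simp [prefixProb_nil]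
  | append_singleton u σ ih =>
    rw [prefixProb_append_singleton]
    exact mul_nonneg ih ((L u).2.1 _)

theorem isDef_nil {S : Type*} [Fintype S] (L : LanguageModel S) : IsDef L [] := by
  simp [IsDef, prefixProb_nil]

theorem isDef_append_singleton {S : Type*} [Fintype S] (L : LanguageModel S)
    (u : List S) (σ : S) : IsDef L (u ++ [σ]) ↔ IsDef L u ∧ σ ∈ supp (L u) := by
  have h1 := prefixProb_nonneg L u
  have h2 : 0 ≤ (L u).1 (some σ) := (L u).2.1 _
  simp only [IsDef, prefixProb_append_singleton, supp, Set.mem_ofPred_eq]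
  constructor
  · intro h
    exact ⟨pos_of_mul_pos_left h h2, pos_of_mul_pos_right h h1⟩
  · rintro ⟨h, h'⟩
    exact mul_pos h h'

/-! ### The congruence -/

/-- An equivalence relation on distributions whose equivalent elements have the same support. -/
structure SuppEquiv (S : Type*) [Fintype S] where
  rel : Setoid (Dist S)
  supp_eq : ∀ ρ ρ' : Dist S, rel ρ ρ' → supp ρ = supp ρ'

/-- The relation on strings: both undefined, or both defined with equivalent next-symbol
distributions after every common defined continuation. -/
def Cong {S : Type*} [Fintype S] (E : SuppEquiv S) (L : LanguageModel S) (u v : List S) : Prop :=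
  (IsDef L u ↔ IsDef L v) ∧
    ∀ w : List S, IsDef L (u ++ w) → IsDef L (v ++ w) → E.rel (L (u ++ w)) (L (v ++ w))

theorem Cong.symm {S : Type*} [Fintype S] {E : SuppEquiv S} {L : LanguageModel S}
    {u v : List S} (h : Cong E L u v) : Cong E L v u :=
  ⟨h.1.symm, fun w hu hv => E.rel.symm' (h.2 w hv hu)⟩

theorem Cong.isDef_append {S : Type*} [Fintype S] {E : SuppEquiv S} {L : LanguageModel S}
    {u v : List S} (h : Cong E L u v) (w : List S) (hu : IsDef L (u ++ w)) :
    IsDef L (v ++ w) := by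
  induction w using List.reverseRecOn with
  | nil => simpa using h.1.1 (by simpa using hu)
  | append_singleton w σ ih =>
    rw [← List.append_assoc, isDef_append_singleton] at hu ⊢
    have hv := ih hu.1
    refine ⟨hv, ?_⟩
    rw [← E.supp_eq _ _ (h.2 w hu.1 hv)]
    exact hu.2

/-- The congruence as an equivalence relation on strings. -/
def congSetoid {S : Type*} [Fintype S] (E : SuppEquiv S) (L : LanguageModel S) :
    Setoid (List S) where
  r := Cong E L
  iseqv :=
    { refl := fun _ => ⟨Iff.rfl, fun _ _ _ => E.rel.refl' _⟩
      symm := fun h => h.symm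
      trans := fun h h' => ⟨h.1.trans h'.1, fun x hu hw =>
        E.rel.trans' (h.2 x hu (h.isDef_append x hu)) (h'.2 x (h.isDef_append x hu) hw)⟩ }

theorem Cong.append_singleton {S : Type*} [Fintype S] {E : SuppEquiv S} {L : LanguageModel S}
    {u v : List S} (h : Cong E L u v) (σ : S) : Cong E L (u ++ [σ]) (v ++ [σ]) := by
  refine ⟨⟨h.isDef_append [σ], h.symm.isDef_append [σ]⟩, fun w hu hv => ?_⟩
  rw [List.append_assoc] at hu hv ⊢
  rw [List.append_assoc]
  exact h.2 _ hu hv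

/-- Congruence classes of strings. -/
abbrev StrClass {S : Type*} [Fintype S] (E : SuppEquiv S) (L : LanguageModel S) : Type _ :=
  Quotient (congSetoid E L)

/-- Appending a symbol to a class. -/
def StrClass.step {S : Type*} [Fintype S] {E : SuppEquiv S} {L : LanguageModel S}
    (c : StrClass E L) (σ : S) : StrClass E L :=
  Quotient.map (sa := congSetoid E L) (sb := congSetoid E L) (fun u => u ++ [σ])
    (fun _ _ h => Cong.append_singleton h σ) c

/-- A class is defined if its strings are; all undefined strings form one single class. -/
def StrClass.IsDef {S : Type*} [Fintype S] {E : SuppEquiv S} {L : LanguageModel S}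
    (c : StrClass E L) : Prop :=
  Quotient.lift (s := congSetoid E L) (fun u => OmitZero.IsDef L u)
    (fun u v h => propext (show Cong E L u v from h).1) c

/-- The classes of defined strings. -/
abbrev DefClass {S : Type*} [Fintype S] (E : SuppEquiv S) (L : LanguageModel S) : Type _ :=
  {c : StrClass E L // c.IsDef}

/-! ### Automata -/

/-- A probabilistic deterministic finite automaton (finiteness of `Q` is assumed where used). -/
structure PDFA (S Q : Type*) [Fintype S] where
  init : Q
  policy : Q → Dist S
  trans : Q → S → Q

/-- The language model of a PDFA. -/
def PDFA.model {S Q : Type*} [Fintype S] (A : PDFA S Q) : LanguageModel S :=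
  fun u => A.policy (u.foldl A.trans A.init)

/-- A PDFA whose transitions may be undefined (`none`). -/
structure PartialPDFA (S Q : Type*) [Fintype S] where
  init : Q
  policy : Q → Dist S
  trans : Q → S → Option Q

namespace PartialPDFA

/-- The state reached from `q` along positive-probability transitions, if the string is defined. -/
noncomputable def runFrom {S Q : Type*} [Fintype S] (B : PartialPDFA S Q) : Q → List S → Option Q
  | q, [] => some q
  | q, σ :: w =>
    if σ ∈ supp (B.policy q) then (B.trans q σ).bind fun q' => B.runFrom q' w else none

/-- The state reached by a string that is defined in `B`; `none` if the string is undefined. -/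
noncomputable def run {S Q : Type*} [Fintype S] (B : PartialPDFA S Q) (u : List S) : Option Q :=
  B.runFrom B.init u

/-- `B` is equivalent to `L`: the same strings are defined, and on these the next-symbol
distributions are equivalent. -/
def EquivTo {S Q : Type*} [Fintype S] (B : PartialPDFA S Q) (E : SuppEquiv S)
    (L : LanguageModel S) : Prop :=
  ∀ u : List S, (IsDef L u ↔ ∃ q, B.run u = some q) ∧
    ∀ q, B.run u = some q → E.rel (L u) (B.policy q)

/-- Isomorphism of automata. -/
def Iso {S Q Q' : Type*} [Fintype S] (B : PartialPDFA S Q) (B' : PartialPDFA S Q') : Prop :=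
  ∃ f : Q ≃ Q', f B.init = B'.init ∧ (∀ q, B'.policy (f q) = B.policy q) ∧
    ∀ q σ, B'.trans (f q) σ = (B.trans q σ).map f

end PartialPDFA

/-- A choice of access strings, one in every defined class, the empty one for the initial class. -/
structure AccessChoice {S : Type*} [Fintype S] (E : SuppEquiv S) (L : LanguageModel S) where
  access : DefClass E L → List S
  access_mem : ∀ c, (⟦access c⟧ : StrClass E L) = c.1
  access_init : access ⟨⟦[]⟧, isDef_nil L⟩ = []

/-- The quotient automaton for a choice of access strings. Its states are the classes of defined
strings; a transition into the class of the undefined strings is an undefined transition. -/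
noncomputable def quotientPDFA {S Q : Type*} [Fintype S] (A : PDFA S Q) (E : SuppEquiv S)
    (α : AccessChoice E A.model) : PartialPDFA S (DefClass E A.model) where
  init := ⟨⟦[]⟧, isDef_nil A.model⟩
  policy c := A.model (α.access c)
  trans c σ := if h : (c.1.step σ).IsDef then some ⟨c.1.step σ, h⟩ else none

/-! ### The tree -/

/-- Answer to a membership query, up to equivalence: the class of the next-symbol distribution
of a defined string, and `none` (undefined) for an undefined string. -/
noncomputable def label {S : Type*} [Fintype S] (E : SuppEquiv S) (L : LanguageModel S)
    (u : List S) : Option (Quotient E.rel) :=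
  if IsDef L u then some (Quotient.mk E.rel (L u)) else none

/-- Classification trees: leaves carry access strings, inner nodes carry distinguishing strings,
and the arcs leaving a node carry pairwise different labels of type `K`; `empty` stands for the
absence of an arc. -/
inductive Tree (S : Type*) (K : Type*) where
  | empty : Tree S K
  | leaf (u : List S) : Tree S K
  | node (w : List S) (child : K → Tree S K) : Tree S K

namespace Tree

/-- The set of access strings. -/
def acc {S K : Type*} : Tree S K → Set (List S)
  | empty => ∅
  | leaf u => {u}
  | node _ child => ⋃ k, (child k).acc

/-- Descend from the root, at a node `w` along the arc with the label of `x ++ w`; the result is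
the leaf that is reached, or `none` if an arc is missing. -/
def sift {S K : Type*} (lab : List S → K) : Tree S K → List S → Option (List S)
  | empty, _ => none
  | leaf u, _ => some u
  | node w child, x => (child (lab (x ++ w))).sift lab x

/-- Add `x` as a new leaf at the place where an arc is missing when `x` is sifted. -/
noncomputable def siftUpdate {S K : Type*} (lab : List S → K) : Tree S K → List S → Tree S K
  | empty, x => leaf x
  | leaf u, _ => leaf u
  | node w child, x =>
    node w (Function.update child (lab (x ++ w)) ((child (lab (x ++ w))).siftUpdate lab x))

/-- The lowest common ancestor of the places to which `x` and `y` are sifted, that is, the node at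
which they take different arcs; `none` if they take the same arcs all the way. -/
noncomputable def lca {S K : Type*} (lab : List S → K) :
    Tree S K → List S → List S → Option (List S)
  | empty, _, _ => none
  | leaf _, _, _ => none
  | node w child, x, y =>
    if lab (x ++ w) = lab (y ++ w) then (child (lab (x ++ w))).lca lab x y else some w

/-- An inner node `d` with two leaves `u` and `x`. -/
noncomputable def fork {S K : Type*} (lab : List S → K) (d u x : List S) : Tree S K :=
  node d (Function.update (Function.update (fun _ => empty) (lab (u ++ d)) (leaf u))
    (lab (x ++ d)) (leaf x))

/-- Replace the leaf `u` to which `x` is sifted by an inner node `d` with leaves `u` and `x`. -/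
noncomputable def split {S K : Type*} (lab : List S → K) (d : List S) :
    Tree S K → List S → Tree S K
  | empty, _ => empty
  | leaf u, x => fork lab d u x
  | node w child, x =>
    node w (Function.update child (lab (x ++ w)) ((child (lab (x ++ w))).split lab d x))

theorem mem_acc_of_sift {S K : Type*} (lab : List S → K) (T : Tree S K) (x u : List S)
    (h : T.sift lab x = some u) : u ∈ T.acc := by
  induction T with
  | empty => simp [sift] at h
  | leaf v => simpa [sift, acc, eq_comm] using h
  | node w child ih => exact Set.mem_iUnion.2 ⟨_, ih _ h⟩

end Tree

/-! ### The algorithm -/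

/-- A hypothesis: an automaton whose states are access strings. -/
structure Hypothesis (S : Type*) [Fintype S] where
  acc : Set (List S)
  aut : PartialPDFA S acc

/-- The one-state hypothesis, with a loop for every symbol of positive probability. -/
noncomputable def initialHypothesis {S : Type*} [Fintype S] (L : LanguageModel S) :
    Hypothesis S where
  acc := {[]}
  aut :=
    { init := ⟨[], rfl⟩
      policy := fun u => L u.1
      trans := fun u σ => if σ ∈ supp (L u.1) then some u else none }

/-- The hypothesis of a tree: the states are the leaves, and the successor of `u` under a symbol
`σ` of positive probability is the leaf to which `u ++ [σ]` is sifted. -/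
noncomputable def build {S : Type*} [Fintype S] (E : SuppEquiv S) (L : LanguageModel S)
    (T : Tree S (Option (Quotient E.rel))) (h : [] ∈ T.acc) : Hypothesis S where
  acc := T.acc
  aut :=
    { init := ⟨[], h⟩
      policy := fun u => L u.1
      trans := fun u σ =>
        if σ ∈ supp (L u.1) then
          (T.sift (label E L) (u.1 ++ [σ])).pmap (fun v hv => ⟨v, hv⟩)
            (fun _ hv => T.mem_acc_of_sift (label E L) _ _ hv)
        else none }

/-- `γ` is a counterexample to `H`: it is defined in `H`, and its next-symbol distributions
in `L` and in `H` are not equivalent. -/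
def IsCounterexample {S : Type*} [Fintype S] (E : SuppEquiv S) (L : LanguageModel S)
    (H : Hypothesis S) (γ : List S) : Prop :=
  ∃ q, H.aut.run γ = some q ∧ ¬ E.rel (L γ) (H.aut.policy q)

/-- The initial tree: the root is the empty distinguishing string, and the leaves are the empty
string and `x`. -/
noncomputable def initialTree {S : Type*} [Fintype S] (E : SuppEquiv S) (L : LanguageModel S)
    (x : List S) : Tree S (Option (Quotient E.rel)) :=
  Tree.fork (label E L) [] [] x

/-- Configurations of the algorithm: before the first equivalence query, in the main loop with
the current tree, and after an automaton has been returned. -/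
inductive Config (S : Type*) [Fintype S] (E : SuppEquiv S) where
  | start : Config S E
  | loop (T : Tree S (Option (Quotient E.rel))) : Config S E
  | done (H : Hypothesis S) : Config S E

/-- The steps of the algorithm on the target `L`. The teacher may answer an equivalence query by
any counterexample, and says that there is none exactly if there is none. -/
inductive Step {S : Type*} [Fintype S] (E : SuppEquiv S) (L : LanguageModel S) :
    Config S E → Config S E → Prop
  /-- The initial hypothesis has no counterexample and is returned. -/
  | initReturn (h : ∀ γ, ¬ IsCounterexample E L (initialHypothesis L) γ) :
      Step E L .start (.done (initialHypothesis L))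
  /-- The teacher answers by `γ`; its shortest prefix `x` that is a counterexample becomes
  an access string. -/
  | initTree (γ x : List S) (hγ : IsCounterexample E L (initialHypothesis L) γ) (hx : x <+: γ)
      (hbad : IsCounterexample E L (initialHypothesis L) x)
      (hmin : ∀ y, y <+: x → y ≠ x → ¬ IsCounterexample E L (initialHypothesis L) y) :
      Step E L .start (.loop (initialTree E L x))
  /-- While the automaton is built, sifting `u ++ [σ]` meets a missing arc, and a leaf is added. -/
  | siftNew (T : Tree S (Option (Quotient E.rel))) (u : List S) (σ : S) (hu : u ∈ T.acc)
      (hσ : σ ∈ supp (L u)) (hs : T.sift (label E L) (u ++ [σ]) = none) :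
      Step E L (.loop T) (.loop (T.siftUpdate (label E L) (u ++ [σ])))
  /-- The automaton is complete, has no counterexample, and is returned. -/
  | loopReturn (T : Tree S (Option (Quotient E.rel))) (h0 : [] ∈ T.acc)
      (hT : ∀ u ∈ T.acc, ∀ σ ∈ supp (L u), T.sift (label E L) (u ++ [σ]) ≠ none)
      (h : ∀ γ, ¬ IsCounterexample E L (build E L T h0) γ) :
      Step E L (.loop T) (.done (build E L T h0))
  /-- The automaton is complete and the teacher answers by `γ`. Let `x ++ [σ]` be the shortest
  prefix of `γ` that is not sifted to the state `q` that it reaches in the automaton, and `w` the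
  lowest common ancestor. The leaf to which `x` is sifted is split by `σ :: w`. -/
  | update (T : Tree S (Option (Quotient E.rel))) (h0 : [] ∈ T.acc)
      (hT : ∀ u ∈ T.acc, ∀ σ ∈ supp (L u), T.sift (label E L) (u ++ [σ]) ≠ none)
      (γ : List S) (hγ : IsCounterexample E L (build E L T h0) γ)
      (x : List S) (σ : S) (hx : x ++ [σ] <+: γ)
      (hagree : ∀ y, y <+: x →
        ∃ p, (build E L T h0).aut.run y = some p ∧ T.sift (label E L) y = some p.1)
      (q : (build E L T h0).acc) (hq : (build E L T h0).aut.run (x ++ [σ]) = some q)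
      (w : List S) (hw : T.lca (label E L) (x ++ [σ]) q.1 = some w) :
      Step E L (.loop T) (.loop (T.split (label E L) (σ :: w) x))

end OmitZero

/-!
Every tree of a run separates its leaves: two leaves that part at a node `w` have different labels
after `w`, whereas congruent strings have equal labels after every string. Hence the leaves are
pairwise incongruent defined strings, so there are at most as many of them as defined classes, and
since every step adds a leaf, every run is finite.

A counterexample can always be processed. Its label is not the one of the state reached in the
hypothesis, so sifting it does not lead to that state, and there is a first prefix `xσ` where the
two disagree. If `w` is the node where they part, then `σw` separates `x` from the leaf to which it
is sifted.

A hypothesis without counterexamples is equivalent to the target. Every automaton equivalent to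
the target has at least as many states as there are defined classes, and a returned hypothesis has
at most as many, so its states are in bijection with the defined classes.
-/

namespace OmitZero

section Prefix

variable {α : Type*} {P : List α → Prop} {γ : List α}

theorem exists_minimal_prefix (h : P γ) :
    ∃ x, x <+: γ ∧ P x ∧ ∀ y, y <+: x → y ≠ x → ¬ P y := by
  obtain ⟨x, ⟨hxγ, hx⟩, hmin⟩ := (measure List.length).wf.has_min {x | x <+: γ ∧ P x}
    ⟨γ, List.prefix_rfl, h⟩
  refine ⟨x, hxγ, hx, fun y hyx hne hy => hmin y ⟨hyx.trans hxγ, hy⟩ ?_⟩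
  exact lt_of_le_of_ne hyx.length_le fun hlen => hne (hyx.eq_of_length hlen)

theorem ne_append_singleton_of_prefix {x y : List α} (h : y <+: x) (a : α) : y ≠ x ++ [a] := by
  rintro rfl
  simpa using h.length_le

theorem exists_minimal_prefix_append_singleton_not (hnil : P []) (hγ : ¬ P γ) :
    ∃ x a, x ++ [a] <+: γ ∧ (∀ y, y <+: x → P y) ∧ ¬ P (x ++ [a]) := by
  obtain ⟨z, hzγ, hz, hmin⟩ := exists_minimal_prefix (P := fun y => ¬ P y) hγ
  cases z using List.reverseRecOn with
  | nil => exact absurd hnil hz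
  | append_singleton x a =>
    exact ⟨x, a, hzγ, fun y hy => not_not.1 <| hmin y (hy.trans (List.prefix_append x [a]))
      (ne_append_singleton_of_prefix hy a), hz⟩

end Prefix

namespace Tree

variable {S K : Type*} {lab : List S → K} {T T' : Tree S K} {d u v w x y z : List S}
  {child : K → Tree S K}

/-- A tree is consistent if every leaf lies where it is sifted to: the arcs on the path from the
root to a leaf `u` carry the labels of `u`. -/
def Consistent (lab : List S → K) : Tree S K → Prop
  | empty => True
  | leaf _ => True
  | node w child => ∀ k, (child k).Consistent lab ∧ ∀ u ∈ (child k).acc, lab (u ++ w) = k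

theorem mem_acc_node : u ∈ (node w child).acc ↔ ∃ k, u ∈ (child k).acc := Set.mem_iUnion

theorem Consistent.sift_eq_self (hT : T.Consistent lab) (hu : u ∈ T.acc) :
    T.sift lab u = some u := by
  induction T with
  | empty => exact hu.elim
  | leaf v => exact congrArg some (show u = v from hu).symm
  | node w child ih =>
    obtain ⟨k, hk⟩ := mem_acc_node.1 hu
    simp only [sift, (hT k).2 u hk]
    exact ih k (hT k).1 hk

theorem Consistent.notMem_acc_of_sift_eq_none (hT : T.Consistent lab)
    (h : T.sift lab x = none) : x ∉ T.acc := fun hx => by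
  simp [hT.sift_eq_self hx] at h

theorem Consistent.notMem_acc_of_sift_ne (hT : T.Consistent lab) (h : T.sift lab x = some u)
    (hne : u ≠ x) : x ∉ T.acc := fun hx =>
  hne (Option.some.inj (h.symm.trans (hT.sift_eq_self hx)))

theorem Consistent.label_eq_of_sift_node (hT : (node w child).Consistent lab)
    (h : (node w child).sift lab x = some u) : lab (x ++ w) = lab (u ++ w) :=
  ((hT _).2 u (mem_acc_of_sift lab _ x u h)).symm

theorem sift_congr (h : ∀ w, lab (x ++ w) = lab (y ++ w)) : T.sift lab x = T.sift lab y := by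
  induction T with
  | empty => rfl
  | leaf v => rfl
  | node w child ih =>
    simp only [sift, h w]
    exact ih _

theorem sift_eq_of_lca_eq_none (h : T.lca lab x y = none) : T.sift lab x = T.sift lab y := by
  induction T with
  | empty => rfl
  | leaf v => rfl
  | node w child ih =>
    by_cases hk : lab (x ++ w) = lab (y ++ w)
    · simp only [lca, if_pos hk] at h
      simp only [sift, ← hk]
      exact ih _ h
    · simp [lca, hk] at h

theorem label_ne_of_lca_eq_some (h : T.lca lab x y = some w) : lab (x ++ w) ≠ lab (y ++ w) := by
  induction T with
  | empty => simp [lca] at h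
  | leaf v => simp [lca] at h
  | node d child ih =>
    by_cases hk : lab (x ++ d) = lab (y ++ d)
    · simp only [lca, if_pos hk] at h
      exact ih _ h
    · simp only [lca, if_neg hk, Option.some.injEq] at h
      exact h ▸ hk

theorem Consistent.label_eq_of_lca_eq_some (hT : T.Consistent lab) (hz : T.sift lab z = some v)
    (h : T.lca lab x v = some w) : lab (z ++ w) = lab (v ++ w) := by
  induction T with
  | empty => simp [lca] at h
  | leaf u => simp [lca] at h
  | node d child ih =>
    have hzv : lab (z ++ d) = lab (v ++ d) := hT.label_eq_of_sift_node hz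
    by_cases hk : lab (x ++ d) = lab (v ++ d)
    · simp only [lca, hk, ← hzv] at h
      exact ih _ (hT _).1 hz h
    · simp only [lca, if_neg hk, Option.some.injEq] at h
      exact h ▸ hzv

theorem acc_node_update {k : K} (h : T'.acc = insert x (child k).acc) :
    (node w (Function.update child k T')).acc = insert x (node w child).acc := by
  ext u
  have hchild : (∃ j, u ∈ (child j).acc) ↔ u ∈ (child k).acc ∨ ∃ j ≠ k, u ∈ (child j).acc := by
    simpa using Function.exists_update_iff child (a := k) (b := child k) fun _ T => u ∈ T.acc
  rw [mem_acc_node, Function.exists_update_iff child fun _ T => u ∈ T.acc, h,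
    Set.mem_insert_iff, Set.mem_insert_iff, mem_acc_node, hchild, or_assoc]

theorem Consistent.node_update (hT : (node w child).Consistent lab) (hT' : T'.Consistent lab)
    (h : T'.acc = insert x (child (lab (x ++ w))).acc) :
    (node w (Function.update child (lab (x ++ w)) T')).Consistent lab := by
  refine (Function.forall_update_iff child
    fun k T => T.Consistent lab ∧ ∀ u ∈ T.acc, lab (u ++ w) = k).2 ⟨⟨hT', ?_⟩, fun k _ => hT k⟩
  rw [h]
  rintro u (rfl | hu)
  exacts [rfl, (hT _).2 u hu]

theorem acc_siftUpdate (h : T.sift lab x = none) :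
    (T.siftUpdate lab x).acc = insert x T.acc := by
  induction T with
  | empty => simp [siftUpdate, acc]
  | leaf v => simp [sift] at h
  | node w child ih => exact acc_node_update (ih _ h)

theorem Consistent.siftUpdate (hT : T.Consistent lab) (h : T.sift lab x = none) :
    (T.siftUpdate lab x).Consistent lab := by
  induction T with
  | empty => trivial
  | leaf v => trivial
  | node w child ih => exact hT.node_update (ih _ (hT _).1 h) (acc_siftUpdate h)

theorem acc_fork (h : lab (u ++ d) ≠ lab (x ++ d)) : (fork lab d u x).acc = {x, u} := by
  rw [fork, acc_node_update (x := x) (by simp [Function.update_of_ne h.symm, acc]),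
    acc_node_update (x := u) (by simp [acc])]
  simp [acc]

theorem consistent_fork (h : lab (u ++ d) ≠ lab (x ++ d)) : (fork lab d u x).Consistent lab := by
  have hempty : (node d fun _ => empty).Consistent lab := fun _ => ⟨trivial, fun _ => False.elim⟩
  exact (hempty.node_update (T' := leaf u) trivial (by simp [acc])).node_update (T' := leaf x)
    trivial (by simp [Function.update_of_ne h.symm, acc])

theorem acc_split (hu : T.sift lab x = some u) (h : lab (u ++ d) ≠ lab (x ++ d)) :
    (T.split lab d x).acc = insert x T.acc := by
  induction T with
  | empty => simp [sift] at hu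
  | leaf v =>
    obtain rfl : v = u := Option.some.inj hu
    exact acc_fork h
  | node w child ih => exact acc_node_update (ih _ hu)

theorem Consistent.split (hT : T.Consistent lab) (hu : T.sift lab x = some u)
    (h : lab (u ++ d) ≠ lab (x ++ d)) : (T.split lab d x).Consistent lab := by
  induction T with
  | empty => trivial
  | leaf v =>
    obtain rfl : v = u := Option.some.inj hu
    exact consistent_fork h
  | node w child ih => exact hT.node_update (ih _ (hT _).1 hu) (acc_split hu h)

end Tree

variable {S : Type*} [Fintype S] {E : SuppEquiv S} {L : LanguageModel S}

theorem label_eq_label_iff {u v : List S} (hv : IsDef L v) :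
    label E L u = label E L v ↔ IsDef L u ∧ E.rel (L u) (L v) := by
  by_cases hu : IsDef L u <;> simp [label, hu, hv, Quotient.eq]

theorem Cong.label_eq {u v : List S} (h : Cong E L u v) (w : List S) :
    label E L (u ++ w) = label E L (v ++ w) := by
  by_cases hv : IsDef L (v ++ w)
  · have hu := h.symm.isDef_append w hv
    exact (label_eq_label_iff hv).2 ⟨hu, h.2 w hu hv⟩
  · have hu : ¬ IsDef L (u ++ w) := fun hu => hv (h.isDef_append w hu)
    simp [label, hu, hv]

theorem isDef_out (c : DefClass E L) : IsDef L c.1.out := by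
  have hc := c.2
  rwa [← Quotient.out_eq c.1] at hc

namespace PartialPDFA

variable {Q : Type*} {B : PartialPDFA S Q} {u v : List S} {q : Q}

theorem runFrom_append (B : PartialPDFA S Q) (q : Q) (u w : List S) :
    B.runFrom q (u ++ w) = (B.runFrom q u).bind fun p => B.runFrom p w := by
  induction u generalizing q with
  | nil => rfl
  | cons σ u ih =>
    simp only [List.cons_append, runFrom, ih]
    split_ifs
    · rw [Option.bind_assoc]
    · rfl

theorem run_append (B : PartialPDFA S Q) (u w : List S) :
    B.run (u ++ w) = (B.run u).bind fun p => B.runFrom p w := B.runFrom_append _ _ _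

theorem run_append_singleton_eq_some_iff {σ : S} : B.run (u ++ [σ]) = some q ↔
    ∃ p, B.run u = some p ∧ σ ∈ supp (B.policy p) ∧ B.trans p σ = some q := by
  simp [run_append, Option.bind_eq_some_iff, runFrom]

theorem exists_run_of_prefix (h : u <+: v) (hq : B.run v = some q) : ∃ p, B.run u = some p := by
  obtain ⟨w, rfl⟩ := h
  rw [run_append] at hq
  obtain ⟨p, hp, -⟩ := Option.bind_eq_some_iff.1 hq
  exact ⟨p, hp⟩

theorem EquivTo.cong_of_run_eq (hB : B.EquivTo E L) (hu : B.run u = some q)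
    (hv : B.run v = some q) : Cong E L u v := by
  refine ⟨iff_of_true ((hB u).1.2 ⟨q, hu⟩) ((hB v).1.2 ⟨q, hv⟩), fun w huw _ => ?_⟩
  obtain ⟨p, hp⟩ := (hB _).1.1 huw
  have hp' : B.run (v ++ w) = some p := by rw [run_append, hv, ← hu, ← run_append, hp]
  exact E.rel.trans' ((hB _).2 p hp) (E.rel.symm' ((hB _).2 p hp'))

theorem EquivTo.nonempty_defClass_embedding (hB : B.EquivTo E L) :
    Nonempty (DefClass E L ↪ Q) := by
  choose state hstate using fun c : DefClass E L => (hB _).1.1 (isDef_out c)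
  refine ⟨state, fun c c' h => Subtype.ext (Quotient.out_equiv_out.1 ?_)⟩
  exact hB.cong_of_run_eq (hstate c) (h ▸ hstate c')

theorem isDef_of_run_eq_some (hq : B.run u = some q)
    (h : ∀ v p, v <+: u → v ≠ u → B.run v = some p → E.rel (L v) (B.policy p)) : IsDef L u := by
  induction u using List.reverseRecOn generalizing q with
  | nil => exact isDef_nil L
  | append_singleton u σ ih =>
    obtain ⟨p, hp, hσ, -⟩ := run_append_singleton_eq_some_iff.1 hq
    have hu : ∀ v p, v <+: u → B.run v = some p → E.rel (L v) (B.policy p) := fun v p hv =>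
      h v p (hv.trans (List.prefix_append u [σ])) (ne_append_singleton_of_prefix hv σ)
    rw [isDef_append_singleton, E.supp_eq _ _ (hu u p List.prefix_rfl hp)]
    exact ⟨ih hp fun v p hv _ => hu v p hv, hσ⟩

theorem equivTo_of_forall_rel
    (htrans : ∀ q, ∀ σ ∈ supp (B.policy q), ∃ p, B.trans q σ = some p)
    (h : ∀ u q, B.run u = some q → E.rel (L u) (B.policy q)) : B.EquivTo E L := by
  refine fun u => ⟨⟨fun hu => ?_, fun ⟨q, hq⟩ => ?_⟩, h u⟩
  · induction u using List.reverseRecOn with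
    | nil => exact ⟨B.init, rfl⟩
    | append_singleton u σ ih =>
      obtain ⟨hu, hσ⟩ := (isDef_append_singleton L u σ).1 hu
      obtain ⟨q, hq⟩ := ih hu
      rw [E.supp_eq _ _ (h u q hq)] at hσ
      obtain ⟨p, hp⟩ := htrans q σ hσ
      exact ⟨p, run_append_singleton_eq_some_iff.2 ⟨q, hq, hσ, hp⟩⟩
  · exact isDef_of_run_eq_some hq fun v p _ _ => h v p

end PartialPDFA

namespace PDFA

variable {Q : Type*} (A : PDFA S Q)

/-- A PDFA as an automaton with partial transitions all of which happen to be defined. -/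
def toPartial : PartialPDFA S Q where
  init := A.init
  policy := A.policy
  trans q σ := some (A.trans q σ)

theorem foldl_eq_of_runFrom_toPartial {q p : Q} {u : List S}
    (h : A.toPartial.runFrom q u = some p) : u.foldl A.trans q = p := by
  induction u generalizing q with
  | nil => exact Option.some.inj h
  | cons σ u ih =>
    simp only [PartialPDFA.runFrom] at h
    split_ifs at h
    exact ih h

theorem toPartial_equivTo (E : SuppEquiv S) : A.toPartial.EquivTo E A.model := by
  refine PartialPDFA.equivTo_of_forall_rel (fun q σ _ => ⟨A.trans q σ, rfl⟩) fun u q hq => ?_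
  have hmodel : A.model u = A.policy q := congrArg A.policy (A.foldl_eq_of_runFrom_toPartial hq)
  rw [hmodel]
  exact E.rel.refl' _

theorem finite_defClass [Finite Q] (E : SuppEquiv S) : Finite (DefClass E A.model) :=
  let ⟨f⟩ := (A.toPartial_equivTo E).nonempty_defClass_embedding
  Finite.of_injective f f.injective

end PDFA

/-- A finite set of pairwise incongruent defined strings; the leaves of every tree of the
algorithm, and the states of every hypothesis, form such a set. -/
structure IsAccessSet (E : SuppEquiv S) (L : LanguageModel S) (U : Set (List S)) : Prop where
  finite : U.Finite
  isDef : ∀ u ∈ U, IsDef L u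
  eq_of_cong : ∀ u ∈ U, ∀ v ∈ U, Cong E L u v → u = v

namespace IsAccessSet

variable {U : Set (List S)}

/-- The class of an access string; distinct access strings have distinct classes. -/
def toClass (hU : IsAccessSet E L U) : U ↪ DefClass E L where
  toFun u := ⟨⟦u.1⟧, hU.isDef u.1 u.2⟩
  inj' u v h :=
    Subtype.ext (hU.eq_of_cong u.1 u.2 v.1 v.2 (Quotient.exact (congrArg Subtype.val h)))

theorem ncard_le [Finite (DefClass E L)] (hU : IsAccessSet E L U) :
    U.ncard ≤ Nat.card (DefClass E L) :=
  Nat.card_le_card_of_injective hU.toClass hU.toClass.injective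

end IsAccessSet

/-- The properties shared by all hypotheses of the algorithm: the states are pairwise incongruent
defined strings, and a transition leads to the state that is congruent to the extended access
string, if there is such a state. -/
structure Hypothesis.Sound (E : SuppEquiv S) (L : LanguageModel S) (H : Hypothesis S) : Prop
    extends IsAccessSet E L H.acc where
  init : H.aut.init.1 = []
  policy : ∀ u, H.aut.policy u = L u.1
  trans_none : ∀ u σ, σ ∉ supp (L u.1) → H.aut.trans u σ = none
  trans_some : ∀ u, ∀ σ ∈ supp (L u.1), ∃ v, H.aut.trans u σ = some v ∧
    ∀ v' ∈ H.acc, Cong E L (u.1 ++ [σ]) v' → v.1 = v'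

namespace Hypothesis.Sound

variable {H : Hypothesis S}

theorem equivTo (hH : H.Sound E L) (h : ∀ γ, ¬ IsCounterexample E L H γ) :
    H.aut.EquivTo E L := by
  refine PartialPDFA.equivTo_of_forall_rel (fun q σ hσ => ?_) fun u q hq => ?_
  · rw [hH.policy] at hσ
    obtain ⟨v, hv, -⟩ := hH.trans_some q σ hσ
    exact ⟨v, hv⟩
  · by_contra hne
    exact h u ⟨q, hq, hne⟩

theorem toClass_bijective (hH : H.Sound E L) (h : H.aut.EquivTo E L) :
    Function.Bijective hH.toClass := by
  have : Finite H.acc := hH.finite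
  obtain ⟨f⟩ := h.nonempty_defClass_embedding
  have : Finite (DefClass E L) := Finite.of_injective f f.injective
  exact hH.toClass.injective.bijective_of_nat_card_le
    (Nat.card_le_card_of_injective f f.injective)

theorem toClass_init (hH : H.Sound E L) : hH.toClass H.aut.init = ⟨⟦[]⟧, isDef_nil L⟩ :=
  Subtype.ext (congrArg (Quotient.mk (congSetoid E L)) hH.init)

theorem exists_trans_toClass_eq_step (hH : H.Sound E L)
    (hsurj : Function.Surjective hH.toClass) (u : H.acc) {σ : S} (hσ : σ ∈ supp (L u.1)) :
    ∃ v, H.aut.trans u σ = some v ∧ (hH.toClass v).1 = (hH.toClass u).1.step σ := by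
  have huσ : IsDef L (u.1 ++ [σ]) := (isDef_append_singleton L _ σ).2 ⟨hH.isDef _ u.2, hσ⟩
  obtain ⟨v, hv, huniq⟩ := hH.trans_some u σ hσ
  obtain ⟨v', hv'⟩ := hsurj ⟨⟦u.1 ++ [σ]⟧, huσ⟩
  have hcong : Cong E L (u.1 ++ [σ]) v'.1 := Quotient.exact (congrArg Subtype.val hv').symm
  obtain rfl : v = v' := Subtype.ext (huniq v'.1 v'.2 hcong)
  exact ⟨v, hv, congrArg Subtype.val hv'⟩

/-- The states of a hypothesis as access strings of the defined classes. -/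
noncomputable def accessChoice (hH : H.Sound E L) (hbij : Function.Bijective hH.toClass) :
    AccessChoice E L where
  access c := ((Equiv.ofBijective _ hbij).symm c).1
  access_mem c := congrArg Subtype.val ((Equiv.ofBijective _ hbij).apply_symm_apply c)
  access_init := by
    rw [← hH.toClass_init, Equiv.ofBijective_symm_apply_apply, hH.init]

theorem iso_quotientPDFA {Q : Type*} {A : PDFA S Q} (hH : H.Sound E A.model)
    (hbij : Function.Bijective hH.toClass) :
    H.aut.Iso (quotientPDFA A E (hH.accessChoice hbij)) := by
  refine ⟨Equiv.ofBijective _ hbij, hH.toClass_init, fun u => ?_, fun u σ => ?_⟩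
  · rw [hH.policy]
    exact congrArg (fun v : H.acc => A.model v.1) (Equiv.ofBijective_symm_apply_apply _ hbij u)
  · have hdef : ((hH.toClass u).1.step σ).IsDef ↔ IsDef A.model u.1 ∧ σ ∈ supp (A.model u.1) :=
      isDef_append_singleton A.model u.1 σ
    by_cases hσ : σ ∈ supp (A.model u.1)
    · obtain ⟨v, hv, hstep⟩ := hH.exists_trans_toClass_eq_step hbij.surjective u hσ
      rw [hv]
      exact (dif_pos (hdef.2 ⟨hH.isDef _ u.2, hσ⟩)).trans
        (congrArg some (Subtype.ext hstep.symm))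
    · rw [hH.trans_none u σ hσ]
      exact dif_neg fun h => hσ (hdef.1 h).2

end Hypothesis.Sound

theorem sound_initialHypothesis : (initialHypothesis L).Sound E L where
  finite := Set.finite_singleton _
  init := rfl
  policy _ := rfl
  isDef := by
    rintro u rfl
    exact isDef_nil L
  eq_of_cong := by
    rintro u rfl v rfl -
    rfl
  trans_none _ _ hσ := if_neg hσ
  trans_some u σ hσ := ⟨u, if_pos hσ, by
    rintro v' rfl -
    exact u.2⟩

/-- The invariant of the main loop. As the root is the empty distinguishing string, sifting
preserves the label of a string. -/
structure TreeInv (E : SuppEquiv S) (L : LanguageModel S)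
    (T : Tree S (Option (Quotient E.rel))) : Prop where
  root : ∃ child, T = .node [] child
  consistent : T.Consistent (label E L)
  finite : T.acc.Finite
  nil_mem : [] ∈ T.acc
  isDef : ∀ u ∈ T.acc, IsDef L u

namespace TreeInv

variable {T T' : Tree S (Option (Quotient E.rel))} {d u w x : List S} {σ : S}

theorem label_eq_of_sift (hT : TreeInv E L T) (h : T.sift (label E L) x = some u) :
    label E L x = label E L u := by
  obtain ⟨child, rfl⟩ := hT.root
  simpa using hT.consistent.label_eq_of_sift_node h

theorem isDef_of_sift (hT : TreeInv E L T) (h : T.sift (label E L) x = some u) : IsDef L x :=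
  ((label_eq_label_iff (hT.isDef u (T.mem_acc_of_sift _ x u h))).1 (hT.label_eq_of_sift h)).1

theorem isAccessSet (hT : TreeInv E L T) : IsAccessSet E L T.acc where
  finite := hT.finite
  isDef := hT.isDef
  eq_of_cong u hu v hv h := Option.some.inj <| by
    rw [← hT.consistent.sift_eq_self hu, ← hT.consistent.sift_eq_self hv,
      Tree.sift_congr h.label_eq]

theorem of_acc_eq_insert (hT : TreeInv E L T) (hroot : ∃ child, T' = .node [] child)
    (hcons : T'.Consistent (label E L)) (hacc : T'.acc = insert x T.acc) (hx : IsDef L x) :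
    TreeInv E L T' where
  root := hroot
  consistent := hcons
  finite := hacc ▸ hT.finite.insert x
  nil_mem := hacc ▸ Set.mem_insert_of_mem x hT.nil_mem
  isDef := hacc ▸ Set.forall_mem_insert.2 ⟨hx, hT.isDef⟩

theorem siftUpdate (hT : TreeInv E L T) (hx : IsDef L x) (h : T.sift (label E L) x = none) :
    TreeInv E L (T.siftUpdate (label E L) x) :=
  hT.of_acc_eq_insert (by obtain ⟨child, rfl⟩ := hT.root; exact ⟨_, rfl⟩)
    (hT.consistent.siftUpdate h) (Tree.acc_siftUpdate h) hx

theorem split (hT : TreeInv E L T) (hu : T.sift (label E L) x = some u)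
    (h : label E L (u ++ d) ≠ label E L (x ++ d)) : TreeInv E L (T.split (label E L) d x) :=
  hT.of_acc_eq_insert (by obtain ⟨child, rfl⟩ := hT.root; exact ⟨_, rfl⟩)
    (hT.consistent.split hu h) (Tree.acc_split hu h) (hT.isDef_of_sift hu)

theorem ncard_acc_siftUpdate (hT : TreeInv E L T) (h : T.sift (label E L) x = none) :
    (T.siftUpdate (label E L) x).acc.ncard = T.acc.ncard + 1 := by
  rw [Tree.acc_siftUpdate h,
    Set.ncard_insert_of_notMem (hT.consistent.notMem_acc_of_sift_eq_none h) hT.finite]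

theorem ncard_acc_split (hT : TreeInv E L T) (hu : T.sift (label E L) x = some u)
    (h : label E L (u ++ d) ≠ label E L (x ++ d)) :
    (T.split (label E L) d x).acc.ncard = T.acc.ncard + 1 := by
  have hne : u ≠ x := by
    rintro rfl
    exact h rfl
  rw [Tree.acc_split hu h,
    Set.ncard_insert_of_notMem (hT.consistent.notMem_acc_of_sift_ne hu hne) hT.finite]

theorem build_trans_eq_some_iff (h0 : [] ∈ T.acc) {u v : (build E L T h0).acc}
    (hσ : σ ∈ supp (L u.1)) : (build E L T h0).aut.trans u σ = some v ↔
      T.sift (label E L) (u.1 ++ [σ]) = some v.1 := by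
  refine (iff_of_eq (congrArg (· = some v) (if_pos hσ))).trans
    (Option.pmap_eq_some_iff.trans ⟨?_, fun h => ⟨v.1, v.2, h, rfl⟩⟩)
  rintro ⟨a, _, ha, rfl⟩
  exact ha

theorem sound_build (hT : TreeInv E L T) (h0 : [] ∈ T.acc)
    (hcomplete : ∀ u ∈ T.acc, ∀ σ ∈ supp (L u), T.sift (label E L) (u ++ [σ]) ≠ none) :
    (build E L T h0).Sound E L where
  toIsAccessSet := hT.isAccessSet
  init := rfl
  policy _ := rfl
  trans_none _ _ hσ := if_neg hσ
  trans_some u σ hσ := by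
    obtain ⟨v, hv⟩ := Option.ne_none_iff_exists'.1 (hcomplete u.1 u.2 σ hσ)
    refine ⟨⟨v, T.mem_acc_of_sift _ _ _ hv⟩, (build_trans_eq_some_iff h0 hσ).2 hv,
      fun v' hv' hcong => ?_⟩
    rw [Tree.sift_congr hcong.label_eq, hT.consistent.sift_eq_self hv'] at hv
    exact (Option.some.inj hv).symm

/-- `p ++ [σ]` is sifted to `q`, so after `w` it has the label of `q`, which `x ++ [σ]` has not. -/
theorem label_append_ne_of_lca (hT : TreeInv E L T) (h0 : [] ∈ T.acc)
    {p q : (build E L T h0).acc} (hp : (build E L T h0).aut.run x = some p)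
    (hq : (build E L T h0).aut.run (x ++ [σ]) = some q)
    (hw : T.lca (label E L) (x ++ [σ]) q.1 = some w) :
    label E L (p.1 ++ σ :: w) ≠ label E L (x ++ σ :: w) := by
  obtain ⟨p', hp', hσ, hpq⟩ := PartialPDFA.run_append_singleton_eq_some_iff.1 hq
  obtain rfl : p = p' := Option.some.inj (hp.symm.trans hp')
  have hlabel := hT.consistent.label_eq_of_lca_eq_some ((build_trans_eq_some_iff h0 hσ).1 hpq) hw
  have hne := Tree.label_ne_of_lca_eq_some hw
  rw [← hlabel] at hne
  simpa using hne.symm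

end TreeInv

theorem label_nil_ne_of_isCounterexample {x : List S}
    (h : IsCounterexample E L (initialHypothesis L) x) : label E L [] ≠ label E L x := by
  obtain ⟨⟨u, rfl⟩, -, hne⟩ := h
  exact fun hlabel => hne ((label_eq_label_iff (isDef_nil L)).1 hlabel.symm).2

theorem treeInv_initialTree {x : List S}
    (hbad : IsCounterexample E L (initialHypothesis L) x)
    (hmin : ∀ y, y <+: x → y ≠ x → ¬ IsCounterexample E L (initialHypothesis L) y) :
    TreeInv E L (initialTree E L x) := by
  have hlabel : label E L ([] ++ []) ≠ label E L (x ++ []) := by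
    simpa using label_nil_ne_of_isCounterexample hbad
  obtain ⟨q, hq, -⟩ := hbad
  have hx : IsDef L x := PartialPDFA.isDef_of_run_eq_some (E := E) hq fun y p hy hne hp =>
    by_contra fun hrel => hmin y hy hne ⟨p, hp, hrel⟩
  have hacc : (initialTree E L x).acc = {x, []} := Tree.acc_fork hlabel
  exact
    { root := ⟨_, rfl⟩
      consistent := Tree.consistent_fork hlabel
      finite := by simp [hacc]
      nil_mem := by simp [hacc]
      isDef := by simp [hacc, hx, isDef_nil] }

/-- The invariant of the reachable configurations. -/
def ConfigInv (E : SuppEquiv S) (L : LanguageModel S) : Config S E → Prop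
  | .start => True
  | .loop T => TreeInv E L T
  | .done H => H.Sound E L ∧ ∀ γ, ¬ IsCounterexample E L H γ

theorem ConfigInv.step {c c' : Config S E} (hc : ConfigInv E L c) (h : Step E L c c') :
    ConfigInv E L c' := by
  cases h with
  | initReturn hno => exact ⟨sound_initialHypothesis, hno⟩
  | initTree γ x _ _ hbad hmin => exact treeInv_initialTree hbad hmin
  | siftNew T u σ hu hσ hs =>
    exact TreeInv.siftUpdate hc ((isDef_append_singleton L u σ).2 ⟨hc.isDef u hu, hσ⟩) hs
  | loopReturn T h0 hcomplete hno => exact ⟨TreeInv.sound_build hc h0 hcomplete, hno⟩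
  | update T h0 _ γ _ x σ _ hagree q hq w hw =>
    obtain ⟨p, hp, hsift⟩ := hagree x List.prefix_rfl
    exact TreeInv.split hc hsift (TreeInv.label_append_ne_of_lca hc h0 hp hq hw)

theorem configInv_of_reachable {c : Config S E} (h : Relation.ReflTransGen (Step E L) .start c) :
    ConfigInv E L c := by
  induction h with
  | refl => trivial
  | tail _ hstep ih => exact ih.step hstep

/-- The number of access strings of a configuration, increased by one after the return so that
every step increases it. -/
noncomputable def Config.rank : Config S E → ℕ
  | .start => 0
  | .loop T => T.acc.ncard
  | .done H => H.acc.ncard + 1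

theorem ConfigInv.rank_lt_of_step {c c' : Config S E} (hc : ConfigInv E L c)
    (h : Step E L c c') : c.rank < c'.rank := by
  cases h with
  | initReturn _ => exact Nat.succ_pos _
  | initTree γ x _ _ hbad hmin =>
    have hT := treeInv_initialTree hbad hmin
    exact (Set.ncard_pos hT.finite).2 ⟨[], hT.nil_mem⟩
  | siftNew T u σ _ _ hs => exact Nat.lt_of_succ_le (TreeInv.ncard_acc_siftUpdate hc hs).ge
  | loopReturn T _ _ _ => exact Nat.lt_succ_self T.acc.ncard
  | update T h0 _ γ _ x σ _ hagree q hq w hw =>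
    obtain ⟨p, hp, hsift⟩ := hagree x List.prefix_rfl
    have hne := TreeInv.label_append_ne_of_lca hc h0 hp hq hw
    exact Nat.lt_of_succ_le (TreeInv.ncard_acc_split hc hsift hne).ge

theorem ConfigInv.rank_le [Finite (DefClass E L)] {c : Config S E} (hc : ConfigInv E L c) :
    c.rank ≤ Nat.card (DefClass E L) + 1 := by
  cases c with
  | start => exact Nat.zero_le _
  | loop T => exact (TreeInv.isAccessSet hc).ncard_le.trans (Nat.le_succ _)
  | done H => exact Nat.succ_le_succ hc.1.ncard_le

theorem not_exists_infinite_run [Finite (DefClass E L)] :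
    ¬ ∃ c : ℕ → Config S E, c 0 = .start ∧ ∀ n, Step E L (c n) (c (n + 1)) := by
  rintro ⟨c, h0, hstep⟩
  have hinv : ∀ n, ConfigInv E L (c n) := by
    intro n
    induction n with
    | zero => exact h0 ▸ trivial
    | succ n ih => exact ih.step (hstep n)
  have hmono : StrictMono fun n => (c n).rank :=
    strictMono_nat_of_lt_succ fun n => (hinv n).rank_lt_of_step (hstep n)
  exact Nat.not_succ_le_self _ (hmono.le_apply.trans (hinv (Nat.card (DefClass E L) + 2)).rank_le)

theorem exists_step_start : ∃ c : Config S E, Step E L .start c := by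
  by_cases h : ∀ γ, ¬ IsCounterexample E L (initialHypothesis L) γ
  · exact ⟨_, .initReturn h⟩
  · push Not at h
    obtain ⟨γ, hγ⟩ := h
    obtain ⟨x, hx, hbad, hmin⟩ := exists_minimal_prefix hγ
    exact ⟨_, .initTree γ x hγ hx hbad hmin⟩

namespace TreeInv

variable {T : Tree S (Option (Quotient E.rel))} {γ : List S}

theorem exists_lca_of_isCounterexample (hT : TreeInv E L T) (h0 : [] ∈ T.acc)
    (hγ : IsCounterexample E L (build E L T h0) γ) :
    ∃ x σ, x ++ [σ] <+: γ ∧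
      (∀ y, y <+: x →
        ∃ p, (build E L T h0).aut.run y = some p ∧ T.sift (label E L) y = some p.1) ∧
      ∃ q w, (build E L T h0).aut.run (x ++ [σ]) = some q ∧
        T.lca (label E L) (x ++ [σ]) q.1 = some w := by
  obtain ⟨qγ, hrun, hne⟩ := hγ
  have hγ_disagree :
      ¬ ∃ p, (build E L T h0).aut.run γ = some p ∧ T.sift (label E L) γ = some p.1 := by
    rintro ⟨p, hp, hsift⟩
    obtain rfl : qγ = p := Option.some.inj (hrun.symm.trans hp)
    exact hne ((label_eq_label_iff (hT.isDef _ qγ.2)).1 (hT.label_eq_of_sift hsift)).2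
  obtain ⟨x, σ, hxγ, hagree, hdisagree⟩ := exists_minimal_prefix_append_singleton_not
    (P := fun y => ∃ p, (build E L T h0).aut.run y = some p ∧ T.sift (label E L) y = some p.1)
    ⟨⟨[], h0⟩, rfl, hT.consistent.sift_eq_self h0⟩ hγ_disagree
  obtain ⟨q, hq⟩ := PartialPDFA.exists_run_of_prefix hxγ hrun
  have hlca : T.lca (label E L) (x ++ [σ]) q.1 ≠ none := fun hnone =>
    hdisagree ⟨q, hq, (Tree.sift_eq_of_lca_eq_none hnone).trans (hT.consistent.sift_eq_self q.2)⟩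
  obtain ⟨w, hw⟩ := Option.ne_none_iff_exists'.1 hlca
  exact ⟨x, σ, hxγ, hagree, q, w, hq, hw⟩

theorem exists_step (hT : TreeInv E L T) : ∃ c, Step E L (.loop T) c := by
  have h0 := hT.nil_mem
  by_cases hcomplete : ∀ u ∈ T.acc, ∀ σ ∈ supp (L u), T.sift (label E L) (u ++ [σ]) ≠ none
  · by_cases hno : ∀ γ, ¬ IsCounterexample E L (build E L T h0) γ
    · exact ⟨_, .loopReturn T h0 hcomplete hno⟩
    · push Not at hno
      obtain ⟨γ, hγ⟩ := hno
      obtain ⟨x, σ, hxγ, hagree, q, w, hq, hw⟩ := hT.exists_lca_of_isCounterexample h0 hγ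
      exact ⟨_, .update T h0 hcomplete γ hγ x σ hxγ hagree q hq w hw⟩
  · push Not at hcomplete
    obtain ⟨u, hu, σ, hσ, hs⟩ := hcomplete
    exact ⟨_, .siftNew T u σ hu hσ hs⟩

end TreeInv

theorem ConfigInv.eq_done_or_exists_step {c : Config S E} (hc : ConfigInv E L c) :
    (∃ H, c = .done H) ∨ ∃ c', Step E L c c' := by
  cases c with
  | start => exact .inr exists_step_start
  | loop T => exact .inr (TreeInv.exists_step hc)
  | done H => exact .inl ⟨H, rfl⟩

end OmitZero

theorem mainTheorem3_general {S Q : Type*} [Fintype S] (A : OmitZero.PDFA S Q)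
    (E : OmitZero.SuppEquiv S) :
    (Finite (OmitZero.DefClass E A.model) → ¬ ∃ c : ℕ → OmitZero.Config S E, c 0 = .start ∧
      ∀ n, OmitZero.Step E A.model (c n) (c (n + 1))) ∧
    (∀ c, Relation.ReflTransGen (OmitZero.Step E A.model) .start c →
      (∃ H, c = .done H) ∨ ∃ c', OmitZero.Step E A.model c c') ∧
    (∀ H, Relation.ReflTransGen (OmitZero.Step E A.model) .start (.done H) →
      (∃ α : OmitZero.AccessChoice E A.model, H.aut.Iso (OmitZero.quotientPDFA A E α)) ∧
      Finite H.acc ∧ H.aut.EquivTo E A.model ∧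
      ∀ {Q' : Type*} (B : OmitZero.PartialPDFA S Q'), B.EquivTo E A.model →
        Nonempty (H.acc ↪ Q')) := by
  refine ⟨fun _ => OmitZero.not_exists_infinite_run,
    fun c hc => (OmitZero.configInv_of_reachable hc).eq_done_or_exists_step, fun H hH => ?_⟩
  obtain ⟨hsound, hno⟩ := OmitZero.configInv_of_reachable hH
  have hequiv := hsound.equivTo hno
  exact ⟨⟨_, hsound.iso_quotientPDFA (hsound.toClass_bijective hequiv)⟩, hsound.finite, hequiv,
    fun B hB => hB.nonempty_defClass_embedding.map hsound.toClass.trans⟩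

theorem mainTheorem3 {S Q : Type*} [Fintype S] [Finite Q] (A : OmitZero.PDFA S Q)
    (E : OmitZero.SuppEquiv S) :
    -- no run is infinite
    (¬ ∃ c : ℕ → OmitZero.Config S E, c 0 = .start ∧
      ∀ n, OmitZero.Step E A.model (c n) (c (n + 1))) ∧
    -- no run gets stuck before it returns an automaton
    (∀ c, Relation.ReflTransGen (OmitZero.Step E A.model) .start c →
      (∃ H, c = .done H) ∨ ∃ c', OmitZero.Step E A.model c c') ∧
    -- every returned automaton is the quotient, and is minimal
    (∀ H, Relation.ReflTransGen (OmitZero.Step E A.model) .start (.done H) →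
      (∃ α : OmitZero.AccessChoice E A.model, H.aut.Iso (OmitZero.quotientPDFA A E α)) ∧
      Finite H.acc ∧ H.aut.EquivTo E A.model ∧
      ∀ (n : ℕ) (B : OmitZero.PartialPDFA S (Fin n)), B.EquivTo E A.model →
        Nat.card H.acc ≤ n) := by
  obtain ⟨hterm, hprogress, hreturn⟩ := mainTheorem3_general A E
  refine ⟨hterm (A.finite_defClass E), hprogress, fun H hH => ?_⟩
  obtain ⟨hiso, hfin, hequiv, hmin⟩ := hreturn H hH
  exact ⟨hiso, hfin, hequiv, fun n B hB => by
    simpa using Nat.card_le_card_of_injective _ (hmin B hB).some.injective⟩
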